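/- Let $V$ be a finite set of nodes and let $G=(V,E)$, $E\subseteq V\times V\times\{1,\dots,m\}$, be a strongly connected automaton with at least one arc; $(u,v,\sigma)\in E$ is an arc from $u$ to $v$ with label $\sigma$. Let $n\ge 1$ and let $\mathcal A=(A_1,\dots,A_m)$ be real $n\times n$ matrices. Let $\|\cdot\|$ be any norm on $\mathbb R^{n\times n}$. Let $E_k$ be the set of paths of length $k$ in $G$ and, for $s\in E_k$ with successive labels $\sigma_1,\dots,\sigma_k$, put $A_s=A_{\sigma_k}\cdots A_{\sigma_1}$. The constrained $p$-radius and the constrained joint spectral radius are $$\rho_p(G,\mathcal A)=\lim_{k\to\infty}\Big[\frac1{|E_k|}\sum_{s\in E_k}\|A_s\|^p\Big]^{\frac1{pk}},\qquad \mathrm{CJSR}(G,\mathcal A)=\lim_{k\to\infty}\max_{s\in E_k}\|A_s\|^{\frac1k}.$$ Let $\rho(A(G))$ be the spectral radius of the adjacency matrix $A(G)$ of $G$, whose $(u,v)$ entry is the number of labels $\sigma$ with $(u,v,\sigma)\in E$. For a positive integer $d$, let $\rho_{\mathrm{SOS},2d}(G,\mathcal A)$ be the infimum of all $\gamma\ge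 0$ for which there are real homogeneous polynomials $p_v$ $(v\in V)$ of degree $2d$ in $n$ variables such that - $\gamma^{2d}p_u(x)-p_v(A_\sigma x)$ is a sum of squares of polynomials for every $(u,v,\sigma)\in E$; - for every $v\in V$, $p_v$ is a sum of squares of polynomials and $p_v(x)>0$ for all $x\neq 0$; - $\sum_{v\in V}\int_{\mathbb S^{n-1}}p_v(x)\,\mathrm dx=1$, the integral being taken over the Euclidean unit sphere with respect to surface measure. **Theorem.** For every positive integer $d$, this program is feasible, the limits defining $\rho_{2d}(G,\mathcal A)$ and $\mathrm{CJSR}(G,\mathcal A)$ exist, and $$\rho_{\mathrm{SOS},2d}(G,\mathcal A)\;\le\;\rho(A(G))^{\frac1{2d}}\,\rho_{2d}(G,\mathcal A)\;\le\;\rho(A(G))^{\frac1{2d}}\,\mathrm{CJSR}(G,\mathcal A).$$ -/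

import Mathlib

open Filter Topology MeasureTheory

noncomputable section

/-- A finite automaton with node set `V` and labels in `Fin m`: a labelled directed graph, possibly
with loops and parallel arcs; `(u, v, σ) ∈ arcs` is an arc from `u` to `v` with label `σ`. -/
structure Automaton (V : Type*) (m : ℕ) where
  /-- The set of labelled arcs. -/
  arcs : Finset (V × V × Fin m)

namespace Automaton

variable {V : Type*} {m : ℕ}

/-- Every node can be reached from every node by following arcs. -/
def StronglyConnected (G : Automaton V m) : Prop :=
  ∀ u v : V, Relation.ReflTransGen (fun a b => ∃ σ, (a, b, σ) ∈ G.arcs) u v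

/-- The number of arcs from `u` to `v`, counted with their labels, is the `(u, v)` entry. -/
def adjMatrix [DecidableEq V] (G : Automaton V m) : Matrix V V ℂ :=
  Matrix.of fun u v => ((Finset.univ.filter fun σ : Fin m => (u, v, σ) ∈ G.arcs).card : ℂ)

/-- The spectral radius (largest modulus of a complex eigenvalue) of the adjacency matrix. -/
def adjRadius [Fintype V] [DecidableEq V] (G : Automaton V m) : ℝ :=
  (spectralRadius ℂ G.adjMatrix).toReal

/-- The paths of length `k`: tuples of `k` arcs, each one ending where the next one starts. -/
def paths [Fintype V] [DecidableEq V] (G : Automaton V m) (k : ℕ) :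
    Finset (Fin k → V × V × Fin m) :=
  Finset.univ.filter fun s =>
    (∀ i, s i ∈ G.arcs) ∧ ∀ i j : Fin k, (i : ℕ) + 1 = (j : ℕ) → (s i).2.1 = (s j).1

/-- The word of labels of a tuple of arcs. -/
def label {k : ℕ} (s : Fin k → V × V × Fin m) : Fin k → Fin m := fun i => (s i).2.2

/-- The admissible words of length `k`: the words of labels of the paths of length `k`. -/
def words [Fintype V] [DecidableEq V] (G : Automaton V m) (k : ℕ) : Finset (Fin k → Fin m) :=
  (G.paths k).image label

/-- The product `A_{σ_k} ⋯ A_{σ_1}` along the word `(σ_1, …, σ_k)`. -/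
def wordProd {n k : ℕ} (A : Fin m → Matrix (Fin n) (Fin n) ℝ) (w : Fin k → Fin m) :
    Matrix (Fin n) (Fin n) ℝ :=
  (List.ofFn fun i => A (w i)).reverse.prod

section Radii

variable [Fintype V] [DecidableEq V] {n : ℕ}

/-- The quantity `[|E_k|⁻¹ ∑_{s ∈ E_k} ‖A_s‖^p]^{1/(pk)}`, where `E_k` is the set of paths of
length `k` and `‖·‖ = ν`. -/
def radiusSeq (G : Automaton V m) (A : Fin m → Matrix (Fin n) (Fin n) ℝ)
    (ν : Seminorm ℝ (Matrix (Fin n) (Fin n) ℝ)) (p : ℝ) (k : ℕ) : ℝ :=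
  (((G.paths k).card : ℝ)⁻¹ * ∑ s ∈ G.paths k, ν (wordProd A (label s)) ^ p) ^ (1 / (p * (k : ℝ)))

/-- The constrained `p`-radius, computed with the norm `ν`. -/
def radius (G : Automaton V m) (A : Fin m → Matrix (Fin n) (Fin n) ℝ)
    (ν : Seminorm ℝ (Matrix (Fin n) (Fin n) ℝ)) (p : ℝ) : ℝ :=
  limUnder atTop (G.radiusSeq A ν p)

/-- The quantity `max {‖A_s‖^{1/k}}`, over the admissible words `s` of length `k`. -/
def cjsrSeq (G : Automaton V m) (A : Fin m → Matrix (Fin n) (Fin n) ℝ)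
    (ν : Seminorm ℝ (Matrix (Fin n) (Fin n) ℝ)) (k : ℕ) : ℝ :=
  ⨆ w : G.words k, ν (wordProd A w.1) ^ (1 / (k : ℝ))

/-- The constrained joint spectral radius, computed with the norm `ν`. -/
def cjsr (G : Automaton V m) (A : Fin m → Matrix (Fin n) (Fin n) ℝ)
    (ν : Seminorm ℝ (Matrix (Fin n) (Fin n) ℝ)) : ℝ :=
  limUnder atTop (G.cjsrSeq A ν)

end Radii

/-- The polynomial `p (M x)`. -/
def substMatrix {n : ℕ} (M : Matrix (Fin n) (Fin n) ℝ) (p : MvPolynomial (Fin n) ℝ) :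
    MvPolynomial (Fin n) ℝ :=
  MvPolynomial.bind₁ (fun i => ∑ j, MvPolynomial.C (M i j) * MvPolynomial.X j) p

/-- The integral of the polynomial `p` over the Euclidean unit sphere of `ℝⁿ`, with respect to the
surface measure. -/
def sphereIntegral {n : ℕ} (p : MvPolynomial (Fin n) ℝ) : ℝ :=
  ∫ x : Metric.sphere (0 : EuclideanSpace ℝ (Fin n)) 1,
    MvPolynomial.eval (fun i => (x : EuclideanSpace ℝ (Fin n)) i) p
      ∂(volume : Measure (EuclideanSpace ℝ (Fin n))).toSphere

/-- Feasibility of `(p, γ)` for the sum of squares program of degree `2 * d`. -/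
structure SOSFeasible [Fintype V] {n : ℕ} (G : Automaton V m)
    (A : Fin m → Matrix (Fin n) (Fin n) ℝ) (d : ℕ)
    (p : V → MvPolynomial (Fin n) ℝ) (γ : ℝ) : Prop where
  nonneg : 0 ≤ γ
  homogeneous : ∀ v, (p v).IsHomogeneous (2 * d)
  arc_sos : ∀ u v σ, (u, v, σ) ∈ G.arcs →
    IsSumSq (MvPolynomial.C (γ ^ (2 * d)) * p u - substMatrix (A σ) (p v))
  node_sos : ∀ v, IsSumSq (p v)
  strictly_pos : ∀ v, ∀ x : Fin n → ℝ, x ≠ 0 → 0 < MvPolynomial.eval x (p v)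
  normalized : ∑ v, sphereIntegral (p v) = 1

/-- The values `γ` that are attained by feasible points of the program of degree `2 * d`. -/
def sosValues [Fintype V] {n : ℕ} (G : Automaton V m)
    (A : Fin m → Matrix (Fin n) (Fin n) ℝ) (d : ℕ) : Set ℝ :=
  {γ | ∃ p, G.SOSFeasible A d p γ}

/-- The optimal value of the sum of squares program of degree `2 * d`. -/
def sosBound [Fintype V] {n : ℕ} (G : Automaton V m)
    (A : Fin m → Matrix (Fin n) (Fin n) ℝ) (d : ℕ) : ℝ :=
  sInf (G.sosValues A d)

end Automaton

end

/-! Let `S k` be the sum of `‖A_s‖^(2d)` over the paths of length `k`, in the Frobenius norm.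
Cutting a path in two makes `S` submultiplicative, so `S k ^ (1/k)` tends to some `L`; equivalence
of norms gives the same `L` for `ν`. By Gelfand's formula `|E_k| ^ (1/k)` tends to the spectral
radius of the adjacency matrix (`tendsto_card_paths`). Hence the middle term of the theorem is
exactly `L ^ (1/(2d))`, and the second inequality says that a mean is at most a maximum.

For the first inequality let `γ > L ^ (1/(2d))` and `g = γ^(2d)`, and pick `K > 0` with `S K ≤ g^K`.
The truncated Lyapunov function `p_u(x) = ∑_{k<K} g⁻ᵏ ∑_s |A_s x|^(2d)`, with `s` running over the
paths of length `k` from `u`, is feasible up to scaling. Indeed `g p_u(x) - ∑ p_v(A_σ x)`, summed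
over the arcs leaving `u`, telescopes to `g (|x|^(2d) - g⁻ᴷ ∑_s |A_s x|^(2d))`, with `s` of length
`K` (`isSumSq_sub_sum_lyapunovForm`). This is a sum of squares because `‖M‖^(2d) |x|^(2d) -
|Mx|^(2d)` is one (`isSumSq_sub_substMatrix_normPow`), by Lagrange's identity. The truncation makes
the forms polynomial with no question of convergence. -/

noncomputable section

/-! ### Growth rates of sequences and equivalence of norms -/

/-- The `n`-th roots of a nonnegative submultiplicative sequence converge. -/
theorem exists_tendsto_rpow_one_div_of_submultiplicative {u : ℕ → ℝ} (h0 : ∀ n, 0 ≤ u n)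
    (hu : ∀ k l, u (k + l) ≤ u k * u l) :
    ∃ L : ℝ, 0 ≤ L ∧ Tendsto (fun n : ℕ => u n ^ (1 / (n : ℝ))) atTop (𝓝 L) := by
  -- Since `u` may vanish, Fekete's lemma is applied to the logarithm of `u n + ε ^ n`, which is
  -- positive and still submultiplicative. Taking `n`-th roots, the perturbation costs at most `ε`,
  -- so the original roots form a Cauchy sequence.
  have key : ∀ ε : ℝ, 0 < ε → ∃ L : ℝ,
      Tendsto (fun n : ℕ => (u n + ε ^ n) ^ (1 / (n : ℝ))) atTop (𝓝 L) := by
    intro ε hε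
    have hpos : ∀ n, 0 < u n + ε ^ n := fun n => add_pos_of_nonneg_of_pos (h0 n) (pow_pos hε n)
    have hsub : Subadditive fun n => Real.log (u n + ε ^ n) := by
      intro k l
      rw [← Real.log_mul (hpos k).ne' (hpos l).ne']
      refine Real.log_le_log (hpos _) ?_
      rw [pow_add]
      nlinarith [hu k l, mul_nonneg (h0 k) (pow_pos hε l).le, mul_nonneg (h0 l) (pow_pos hε k).le]
    have hbdd : BddBelow (Set.range fun n : ℕ => Real.log (u n + ε ^ n) / n) := by
      -- The `0` accounts for `n = 0`, where the quotient is `0` by convention.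
      refine ⟨min 0 (Real.log ε), ?_⟩
      rintro _ ⟨n, rfl⟩
      rcases Nat.eq_zero_or_pos n with rfl | hn
      · simp
      · refine (min_le_right _ _).trans ?_
        have hn' : (0 : ℝ) < n := by exact_mod_cast hn
        rw [le_div_iff₀ hn', mul_comm, ← Real.log_pow]
        exact Real.log_le_log (pow_pos hε n) (by linarith [h0 n])
    refine ⟨Real.exp hsub.lim, ?_⟩
    refine ((Real.continuous_exp.tendsto _).comp (hsub.tendsto_lim hbdd)).congr fun n => ?_
    rw [Real.rpow_def_of_pos (hpos n)]
    simp [div_eq_mul_inv]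
  have hcauchy : CauchySeq fun n : ℕ => u n ^ (1 / (n : ℝ)) := by
    rw [Metric.cauchySeq_iff]
    intro ε hε
    obtain ⟨L, hL⟩ := key (ε / 4) (by positivity)
    obtain ⟨N, hN⟩ := Metric.cauchySeq_iff.1 hL.cauchySeq (ε / 4) (by positivity)
    have hclose : ∀ n, 1 ≤ n → u n ^ (1 / (n : ℝ)) ≤ (u n + (ε / 4) ^ n) ^ (1 / (n : ℝ)) ∧
        (u n + (ε / 4) ^ n) ^ (1 / (n : ℝ)) ≤ u n ^ (1 / (n : ℝ)) + ε / 4 := by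
      intro n hn
      have hn' : (1 : ℝ) ≤ n := by exact_mod_cast hn
      have hε4 : (0 : ℝ) ≤ ε / 4 := by positivity
      constructor
      · exact Real.rpow_le_rpow (h0 n) (by linarith [pow_nonneg hε4 n]) (by positivity)
      · refine (Real.rpow_add_le_add_rpow (h0 n) (pow_nonneg hε4 n) (by positivity)
          (by rw [div_le_one (by linarith)]; exact hn')).trans ?_
        rw [one_div, Real.pow_rpow_inv_natCast hε4 (by omega)]
    refine ⟨N + 1, fun k hk l hl => ?_⟩
    have h1 := hN k (by omega) l (by omega)
    have hk' := hclose k (by omega)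
    have hl' := hclose l (by omega)
    rw [Real.dist_eq, abs_lt] at h1 ⊢
    constructor <;> linarith [h1.1, h1.2, hk'.1, hk'.2, hl'.1, hl'.2]
  obtain ⟨L, hL⟩ := cauchySeq_tendsto_of_complete hcauchy
  exact ⟨L, ge_of_tendsto' hL fun n => Real.rpow_nonneg (h0 n) _, hL⟩

theorem tendsto_const_rpow_one_div {c : ℝ} (hc : 0 < c) :
    Tendsto (fun n : ℕ => c ^ (1 / (n : ℝ))) atTop (𝓝 1) := by
  have h := (Real.continuousAt_const_rpow hc.ne' (b := 0)).tendsto.comp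
    (tendsto_one_div_atTop_nhds_zero_nat (𝕜 := ℝ))
  simpa [Function.comp_def] using h

/-- Sequences that agree up to constant factors have the same asymptotic growth rate. -/
theorem tendsto_rpow_one_div_of_le_of_le {u v : ℕ → ℝ} {c C L : ℝ} (hc : 0 < c) (hC : 0 < C)
    (h0 : ∀ n, 0 ≤ u n) (hl : ∀ n, c * u n ≤ v n) (hr : ∀ n, v n ≤ C * u n)
    (h : Tendsto (fun n : ℕ => u n ^ (1 / (n : ℝ))) atTop (𝓝 L)) :
    Tendsto (fun n : ℕ => v n ^ (1 / (n : ℝ))) atTop (𝓝 L) := by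
  have h1 := (tendsto_const_rpow_one_div hc).mul h
  have h2 := (tendsto_const_rpow_one_div hC).mul h
  rw [one_mul] at h1 h2
  refine tendsto_of_tendsto_of_tendsto_of_le_of_le h1 h2 (fun n => ?_) fun n => ?_
  · simp only
    rw [← Real.mul_rpow hc.le (h0 n)]
    exact Real.rpow_le_rpow (mul_nonneg hc.le (h0 n)) (hl n) (by positivity)
  · simp only
    rw [← Real.mul_rpow hC.le (h0 n)]
    exact Real.rpow_le_rpow ((mul_nonneg hc.le (h0 n)).trans (hl n)) (hr n) (by positivity)

/-- A definite seminorm on a finite-dimensional normed space is equivalent to the norm. -/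
theorem Seminorm.exists_equiv_norm {E : Type*} [NormedAddCommGroup E] [NormedSpace ℝ E]
    [FiniteDimensional ℝ E] (ν : Seminorm ℝ E) (hν : ∀ x, ν x = 0 → x = 0) :
    ∃ c C : ℝ, 0 < c ∧ 0 < C ∧ ∀ x, c * ‖x‖ ≤ ν x ∧ ν x ≤ C * ‖x‖ := by
  have hcont : Continuous ν := by
    rw [← continuousOn_univ]
    exact ν.convexOn.continuousOn isOpen_univ
  obtain ⟨C, hC, hCν⟩ := ν.bound_of_continuous_normedSpace hcont
  have : ProperSpace E := FiniteDimensional.proper ℝ E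
  rcases (Metric.sphere (0 : E) 1).eq_empty_or_nonempty with hemp | hne
  · have hzero : ∀ x : E, x = 0 := by
      intro x
      by_contra hx
      have : ‖x‖⁻¹ • x ∈ Metric.sphere (0 : E) 1 := by
        simp [norm_smul, inv_mul_cancel₀ (norm_ne_zero_iff.2 hx)]
      simp [hemp] at this
    exact ⟨1, C, one_pos, hC, fun x => by simp [hzero x]⟩
  · obtain ⟨y, hy, hmin⟩ := (isCompact_sphere (0 : E) 1).exists_isMinOn hne hcont.continuousOn
    have hy1 : ‖y‖ = 1 := by simpa using hy
    have hy0 : 0 < ν y := lt_of_le_of_ne (apply_nonneg ν y) fun h => by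
      simp [hν y h.symm] at hy1
    refine ⟨ν y, C, hy0, hC, fun x => ⟨?_, hCν x⟩⟩
    rcases eq_or_ne x 0 with rfl | hx
    · simp
    · have hxn : 0 < ‖x‖ := norm_pos_iff.2 hx
      have hmem : ‖x‖⁻¹ • x ∈ Metric.sphere (0 : E) 1 := by
        simp [norm_smul, inv_mul_cancel₀ hxn.ne']
      have h := isMinOn_iff.1 hmin _ hmem
      rw [map_smul_eq_mul, norm_inv, norm_norm, inv_mul_eq_div, le_div_iff₀ hxn] at h
      exact h

open scoped Matrix.Norms.Frobenius in
theorem Matrix.frobenius_norm_sq_eq_sum {m n : Type*} [Fintype m] [Fintype n] (M : Matrix m n ℝ) :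
    ‖M‖ ^ 2 = ∑ i, ∑ j, M i j ^ 2 := by
  rw [Matrix.frobenius_norm_def, ← Real.sqrt_eq_rpow, Real.sq_sqrt (by positivity)]
  simp

/-! ### Sums of squares -/

namespace IsSumSq

theorem C_of_nonneg {τ : Type*} {r : ℝ} (hr : 0 ≤ r) :
    IsSumSq (MvPolynomial.C r : MvPolynomial τ ℝ) := by
  rw [← Real.mul_self_sqrt hr, map_mul]
  exact IsSumSq.mul_self _

theorem map_ringHom {R S : Type*} [CommSemiring R] [CommSemiring S] (f : R →+* S) {a : R}
    (ha : IsSumSq a) : IsSumSq (f a) := by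
  induction ha with
  | zero => simp
  | sq_add b _ ih => rw [map_add, map_mul]; exact (IsSumSq.mul_self _).add ih

theorem pow {R : Type*} [CommSemiring R] {a : R} (ha : IsSumSq a) (k : ℕ) : IsSumSq (a ^ k) := by
  induction k with
  | zero => simp
  | succ k ih => rw [pow_succ]; exact ih.mul ha

/-- In `a ^ k - b ^ k = (a - b) ∑ aⁱ bᵏ⁻¹⁻ⁱ` both factors are sums of squares. -/
theorem pow_sub_pow {R : Type*} [CommRing R] {a b : R} (ha : IsSumSq a) (hb : IsSumSq b)
    (hab : IsSumSq (a - b)) (k : ℕ) : IsSumSq (a ^ k - b ^ k) := by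
  rw [← geom_sum₂_mul, mul_comm]
  exact hab.mul (IsSumSq.sum fun i _ => (ha.pow i).mul (hb.pow _))

end IsSumSq

/-! ### Linear substitutions in forms, and the sphere integral -/

namespace Automaton

open MvPolynomial
open scoped Matrix.Norms.Frobenius

/-- The form `(x₁² + ⋯ + xₙ²)ᵈ`. -/
def normPow (n d : ℕ) : MvPolynomial (Fin n) ℝ := (∑ i, X i ^ 2) ^ d

theorem substMatrix_eq_bind₁ {n : ℕ} (M : Matrix (Fin n) (Fin n) ℝ)
    (p : MvPolynomial (Fin n) ℝ) :
    substMatrix M p = bind₁ (fun i => ∑ j, C (M i j) * X j) p := rfl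

theorem isSumSq_substMatrix {n : ℕ} (M : Matrix (Fin n) (Fin n) ℝ) {p : MvPolynomial (Fin n) ℝ}
    (hp : IsSumSq p) : IsSumSq (substMatrix M p) :=
  hp.map_ringHom (bind₁ fun i => ∑ j, C (M i j) * X j).toRingHom

theorem substMatrix_one {n : ℕ} (p : MvPolynomial (Fin n) ℝ) : substMatrix 1 p = p := by
  have h : (fun i : Fin n => ∑ j, C ((1 : Matrix (Fin n) (Fin n) ℝ) i j) * X j) =
      (X : Fin n → MvPolynomial (Fin n) ℝ) := by
    ext1 i
    rw [Finset.sum_eq_single i]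
    · simp
    · intro j _ hj
      simp [Matrix.one_apply_ne hj.symm]
    · simp
  rw [substMatrix_eq_bind₁, h, bind₁_X_left, AlgHom.id_apply]

theorem substMatrix_substMatrix {n : ℕ} (M N : Matrix (Fin n) (Fin n) ℝ)
    (p : MvPolynomial (Fin n) ℝ) :
    substMatrix M (substMatrix N p) = substMatrix (N * M) p := by
  simp only [substMatrix_eq_bind₁, bind₁_bind₁]
  congr 2
  ext1 i
  simp only [map_sum, map_mul, bind₁_X_right, algHom_C, algebraMap_eq, Matrix.mul_apply,
    Finset.mul_sum, Finset.sum_mul]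
  rw [Finset.sum_comm]
  simp only [mul_assoc]

theorem substMatrix_sum {n : ℕ} (M : Matrix (Fin n) (Fin n) ℝ) {ι : Type*} (s : Finset ι)
    (p : ι → MvPolynomial (Fin n) ℝ) :
    substMatrix M (∑ i ∈ s, p i) = ∑ i ∈ s, substMatrix M (p i) := by
  simp only [substMatrix_eq_bind₁, map_sum]

theorem substMatrix_C_mul {n : ℕ} (M : Matrix (Fin n) (Fin n) ℝ) (r : ℝ)
    (p : MvPolynomial (Fin n) ℝ) : substMatrix M (C r * p) = C r * substMatrix M p := by
  simp [substMatrix_eq_bind₁]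

theorem substMatrix_pow {n : ℕ} (M : Matrix (Fin n) (Fin n) ℝ) (p : MvPolynomial (Fin n) ℝ)
    (k : ℕ) : substMatrix M (p ^ k) = substMatrix M p ^ k := by
  simp only [substMatrix_eq_bind₁, map_pow]

theorem isHomogeneous_substMatrix {n k : ℕ} (M : Matrix (Fin n) (Fin n) ℝ)
    {p : MvPolynomial (Fin n) ℝ} (hp : p.IsHomogeneous k) :
    (substMatrix M p).IsHomogeneous k := by
  have h := hp.aeval (fun i => ∑ j, C (M i j) * X j) (n := 1)
    fun i => IsHomogeneous.sum _ _ _ fun j _ => isHomogeneous_C_mul_X _ _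
  rwa [one_mul] at h

theorem isHomogeneous_normPow (n d : ℕ) : (normPow n d).IsHomogeneous (2 * d) :=
  (IsHomogeneous.sum _ _ _ fun i _ => isHomogeneous_X_pow i 2).pow d

theorem isSumSq_normPow (n d : ℕ) : IsSumSq (normPow n d) :=
  IsSumSq.pow (IsSumSq.sum_sq _ _) d

theorem eval_normPow_pos {n : ℕ} (d : ℕ) {x : Fin n → ℝ} (hx : x ≠ 0) :
    0 < eval x (normPow n d) := by
  obtain ⟨i, hi⟩ := Function.ne_iff.1 hx
  simp only [normPow, map_pow, map_sum, eval_X]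
  refine pow_pos (Finset.sum_pos' (fun _ _ => sq_nonneg _) ⟨i, Finset.mem_univ _, ?_⟩) d
  exact sq_pos_of_ne_zero hi

/-- Lagrange's identity: the difference is half the sum of `(a j * x k - a k * x j) ^ 2` over all
ordered pairs. The real scalars supply a square root `h` of `1/2`. -/
theorem isSumSq_lagrange {R ι : Type*} [Fintype ι] [CommRing R] [Algebra ℝ R] (a x : ι → R) :
    IsSumSq ((∑ j, a j ^ 2) * (∑ j, x j ^ 2) - (∑ j, a j * x j) ^ 2) := by
  set h : R := algebraMap ℝ R (Real.sqrt 2)⁻¹ with hdef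
  have hh : h ^ 2 * 2 = 1 := by
    rw [hdef, ← map_pow, inv_pow, Real.sq_sqrt zero_le_two, ← map_ofNat (algebraMap ℝ R) 2,
      ← map_mul, inv_mul_cancel₀ two_ne_zero, map_one]
  have key : (∑ j, a j ^ 2) * (∑ j, x j ^ 2) - (∑ j, a j * x j) ^ 2 =
      ∑ j, ∑ k, (h * (a j * x k - a k * x j)) ^ 2 := by
    have h1 : ∑ j, ∑ k, (h * (a j * x k - a k * x j)) ^ 2 =
        ∑ j, ∑ k, (h ^ 2 * (a j ^ 2 * x k ^ 2) + h ^ 2 * (x j ^ 2 * a k ^ 2) -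
          h ^ 2 * 2 * ((a j * x j) * (a k * x k))) :=
      Finset.sum_congr rfl fun j _ => Finset.sum_congr rfl fun k _ => by ring
    rw [h1]
    simp only [Finset.sum_sub_distrib, Finset.sum_add_distrib, ← Finset.mul_sum,
      ← Finset.sum_mul]
    linear_combination (-(∑ j, a j ^ 2) * (∑ j, x j ^ 2) + (∑ j, a j * x j) ^ 2) * hh
  rw [key]
  exact IsSumSq.sum fun j _ => IsSumSq.sum_sq _ _

/-- The squared Frobenius norm is the sum of the squared lengths of the rows, so Lagrange's identity
applies row by row. -/
theorem isSumSq_sub_substMatrix_sq {n : ℕ} (M : Matrix (Fin n) (Fin n) ℝ) :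
    IsSumSq (C (‖M‖ ^ 2) * (∑ i, X i ^ 2) - substMatrix M (∑ i, X i ^ 2)) := by
  rw [substMatrix_sum, Matrix.frobenius_norm_sq_eq_sum, map_sum, Finset.sum_mul,
    ← Finset.sum_sub_distrib]
  refine IsSumSq.sum fun i _ => ?_
  rw [substMatrix_pow]
  simp only [substMatrix_eq_bind₁, bind₁_X_right, map_sum, map_pow]
  exact isSumSq_lagrange (fun j => C (M i j)) X

/-- `‖M‖²ᵈ (x₁² + ⋯ + xₙ²)ᵈ - ((Mx)₁² + ⋯ + (Mx)ₙ²)ᵈ` is a sum of squares, for the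
Frobenius norm. -/
theorem isSumSq_sub_substMatrix_normPow {n : ℕ} (d : ℕ) (M : Matrix (Fin n) (Fin n) ℝ) :
    IsSumSq (C (‖M‖ ^ (2 * d)) * normPow n d - substMatrix M (normPow n d)) := by
  have h := IsSumSq.pow_sub_pow
    ((IsSumSq.C_of_nonneg (sq_nonneg ‖M‖)).mul (IsSumSq.sum_sq Finset.univ (X (R := ℝ))))
    (isSumSq_substMatrix M (IsSumSq.sum_sq Finset.univ X)) (isSumSq_sub_substMatrix_sq M) d
  rwa [mul_pow, ← map_pow, ← pow_mul, ← substMatrix_pow] at h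

theorem sphereIntegral_pos {n : ℕ} (hn : 0 < n) {p : MvPolynomial (Fin n) ℝ}
    (hp : ∀ x : Fin n → ℝ, x ≠ 0 → 0 < eval x p) : 0 < sphereIntegral p := by
  -- For `n = 0` the sphere is empty and the integral is `0`; a positive dimension makes the surface
  -- measure nonzero.
  have : Nonempty (Fin n) := ⟨⟨0, hn⟩⟩
  have : Nontrivial (EuclideanSpace ℝ (Fin n)) := inferInstance
  have hpos : ∀ x : Metric.sphere (0 : EuclideanSpace ℝ (Fin n)) 1,
      0 < eval (fun i => (x : EuclideanSpace ℝ (Fin n)) i) p := by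
    intro x
    refine hp _ fun h => ?_
    have hx : (x : EuclideanSpace ℝ (Fin n)) = 0 := by
      ext i
      exact congrFun h i
    have := x.2
    simp [hx] at this
  have hcont : Continuous fun x : Metric.sphere (0 : EuclideanSpace ℝ (Fin n)) 1 =>
      eval (fun i => (x : EuclideanSpace ℝ (Fin n)) i) p :=
    (MvPolynomial.continuous_eval p).comp (by fun_prop)
  have hint := hcont.integrable_of_hasCompactSupport
    (μ := (volume : Measure (EuclideanSpace ℝ (Fin n))).toSphere)
    (HasCompactSupport.of_compactSpace _)
  rw [sphereIntegral, integral_pos_iff_support_of_nonneg (fun x => (hpos x).le) hint]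
  have hsupp : (Function.support fun x : Metric.sphere (0 : EuclideanSpace ℝ (Fin n)) 1 =>
      eval (fun i => (x : EuclideanSpace ℝ (Fin n)) i) p) = Set.univ :=
    Set.eq_univ_of_forall fun x => (hpos x).ne'
  rw [hsupp, Measure.measure_univ_pos]
  exact Measure.toSphere_ne_zero _

theorem sphereIntegral_C_mul {n : ℕ} (r : ℝ) (p : MvPolynomial (Fin n) ℝ) :
    sphereIntegral (C r * p) = r * sphereIntegral p := by
  simp only [sphereIntegral, map_mul, eval_C, integral_const_mul]

end Automaton

/-! ### Paths, words and submultiplicativity -/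

namespace Automaton

section Paths

variable {V : Type*} {m : ℕ}

theorem StronglyConnected.exists_arc {G : Automaton V m} (hG : G.StronglyConnected) (harcs : G.arcs.Nonempty)
    (u : V) : ∃ a ∈ G.arcs, a.1 = u := by
  obtain ⟨⟨a, b, σ⟩, h⟩ := harcs
  rcases Relation.ReflTransGen.cases_head (hG u a) with rfl | ⟨c, ⟨τ, hc⟩, -⟩
  · exact ⟨_, h, rfl⟩
  · exact ⟨_, hc, rfl⟩

theorem label_cons {k : ℕ} (a : V × V × Fin m) (s : Fin k → V × V × Fin m) :
    label (Fin.cons a s : Fin (k + 1) → V × V × Fin m) = Fin.cons a.2.2 (label s) := by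
  ext1 i
  refine Fin.cases ?_ (fun i => ?_) i <;> simp [label]

variable [Fintype V] [DecidableEq V] (G : Automaton V m)

theorem mem_paths {k : ℕ} {s : Fin k → V × V × Fin m} : s ∈ G.paths k ↔
    (∀ i, s i ∈ G.arcs) ∧ ∀ i j : Fin k, (i : ℕ) + 1 = (j : ℕ) → (s i).2.1 = (s j).1 := by
  simp [paths]

/-- The paths of length `k` that start at `u`; the path of length `0` starts everywhere. -/
def pathsFrom (u : V) (k : ℕ) : Finset (Fin k → V × V × Fin m) :=
  (G.paths k).filter fun s => ∀ i : Fin k, (i : ℕ) = 0 → (s i).1 = u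

theorem mem_pathsFrom {u : V} {k : ℕ} {s : Fin k → V × V × Fin m} : s ∈ G.pathsFrom u k ↔
    s ∈ G.paths k ∧ ∀ i : Fin k, (i : ℕ) = 0 → (s i).1 = u := by
  simp [pathsFrom]

theorem pathsFrom_subset (u : V) (k : ℕ) : G.pathsFrom u k ⊆ G.paths k :=
  Finset.filter_subset _ _

theorem pathsFrom_zero (u : V) : G.pathsFrom u 0 = Finset.univ := by
  ext s
  simp [mem_pathsFrom, mem_paths, Subsingleton.elim s default]

theorem cons_mem_pathsFrom {u : V} {k : ℕ} {a : V × V × Fin m} {s : Fin k → V × V × Fin m} :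
    (Fin.cons a s : Fin (k + 1) → V × V × Fin m) ∈ G.pathsFrom u (k + 1) ↔
      (a ∈ G.arcs ∧ a.1 = u) ∧ s ∈ G.pathsFrom a.2.1 k := by
  simp only [mem_pathsFrom, mem_paths, Fin.forall_fin_succ, Fin.cons_zero, Fin.cons_succ,
    Fin.val_zero, Fin.val_succ]
  constructor
  · rintro ⟨⟨⟨ha, hs⟩, ⟨-, h1⟩, h2⟩, hu, -⟩
    exact ⟨⟨ha, hu trivial⟩, ⟨hs, fun i j hij => (h2 i).2 j (by omega)⟩,
      fun i hi => (h1 i (by omega)).symm⟩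
  · rintro ⟨⟨ha, hu⟩, ⟨hs, h2⟩, h1⟩
    exact ⟨⟨⟨ha, hs⟩, ⟨fun h => by omega, fun i hi => (h1 i (by omega)).symm⟩,
      fun i => ⟨fun h => by omega, fun j hj => h2 i j (by omega)⟩⟩, fun _ => hu,
      fun i hi => by omega⟩

/-- Splitting off the first arc of a path. -/
theorem sum_pathsFrom_succ {M : Type*} [AddCommMonoid M] (u : V) (k : ℕ)
    (g : (Fin (k + 1) → V × V × Fin m) → M) :
    ∑ s ∈ G.pathsFrom u (k + 1), g s =
      ∑ a ∈ G.arcs with a.1 = u, ∑ s ∈ G.pathsFrom a.2.1 k, g (Fin.cons a s) := by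
  rw [Finset.sum_sigma']
  refine Finset.sum_bij' (fun s _ => ⟨s 0, Fin.tail s⟩) (fun x _ => Fin.cons x.1 x.2) ?_ ?_ ?_ ?_ ?_
  · intro s hs
    rw [← Fin.cons_self_tail s, cons_mem_pathsFrom] at hs
    simpa using hs
  · rintro ⟨a, s⟩ h
    rw [cons_mem_pathsFrom]
    simpa using h
  · intro s _
    simp
  · rintro ⟨a, s⟩ _
    simp
  · intro s _
    simp

variable {G}

theorem StronglyConnected.pathsFrom_nonempty (hG : G.StronglyConnected)
    (harcs : G.arcs.Nonempty) (k : ℕ) : ∀ u, (G.pathsFrom u k).Nonempty := by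
  induction k with
  | zero => intro u; rw [pathsFrom_zero]; exact Finset.univ_nonempty
  | succ k ih =>
    intro u
    obtain ⟨a, ha, hu⟩ := hG.exists_arc harcs u
    obtain ⟨s, hs⟩ := ih a.2.1
    exact ⟨Fin.cons a s, G.cons_mem_pathsFrom.2 ⟨⟨ha, hu⟩, hs⟩⟩

theorem StronglyConnected.paths_nonempty (hG : G.StronglyConnected)
    (harcs : G.arcs.Nonempty) (k : ℕ) : (G.paths k).Nonempty :=
  (hG.pathsFrom_nonempty harcs k harcs.choose.1).mono (G.pathsFrom_subset _ _)

variable (G)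

/-- Only an inequality: the empty path belongs to every `pathsFrom u 0`. -/
theorem card_paths_le_sum [Nonempty V] (k : ℕ) :
    (G.paths k).card ≤ ∑ u, (G.pathsFrom u k).card := by
  refine (Finset.card_le_card fun s hs => ?_).trans Finset.card_biUnion_le
  rw [Finset.mem_biUnion]
  rcases k with _ | k
  · exact ⟨Classical.arbitrary V, Finset.mem_univ _, by rw [pathsFrom_zero]; exact Finset.mem_univ _⟩
  · refine ⟨(s 0).1, Finset.mem_univ _, G.mem_pathsFrom.2 ⟨hs, fun i hi => ?_⟩⟩
    rw [show i = 0 from Fin.ext hi]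

theorem castAdd_mem_paths {k l : ℕ} {s : Fin (k + l) → V × V × Fin m} (hs : s ∈ G.paths (k + l)) :
    (fun i => s (Fin.castAdd l i)) ∈ G.paths k := by
  rw [mem_paths] at hs ⊢
  exact ⟨fun i => hs.1 _, fun i j h => hs.2 _ _ (by simpa using h)⟩

theorem natAdd_mem_paths {k l : ℕ} {s : Fin (k + l) → V × V × Fin m} (hs : s ∈ G.paths (k + l)) :
    (fun i => s (Fin.natAdd k i)) ∈ G.paths l := by
  rw [mem_paths] at hs ⊢
  exact ⟨fun i => hs.1 _, fun i j h => hs.2 _ _ (by simp only [Fin.val_natAdd]; omega)⟩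

section Words

variable {n : ℕ} (A : Fin m → Matrix (Fin n) (Fin n) ℝ)

theorem wordProd_add {k l : ℕ} (w : Fin (k + l) → Fin m) :
    wordProd A w = wordProd A (fun i => w (Fin.natAdd k i)) *
      wordProd A (fun i => w (Fin.castAdd l i)) := by
  simp only [wordProd]
  rw [List.ofFn_add, List.reverse_append, List.prod_append]
  rfl

theorem wordProd_cons {k : ℕ} (σ : Fin m) (w : Fin k → Fin m) :
    wordProd A (Fin.cons σ w : Fin (k + 1) → Fin m) = wordProd A w * A σ := by
  simp [wordProd, List.ofFn_succ]

theorem label_mem_words {k : ℕ} {s : Fin k → V × V × Fin m} (hs : s ∈ G.paths k) :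
    label s ∈ G.words k :=
  Finset.mem_image_of_mem _ hs

/-- Path sums of a submultiplicative weight are submultiplicative in the length. -/
theorem sum_paths_add_le (f : Matrix (Fin n) (Fin n) ℝ → ℝ) (h0 : ∀ M, 0 ≤ f M)
    (hf : ∀ M N, f (M * N) ≤ f M * f N) (k l : ℕ) :
    ∑ s ∈ G.paths (k + l), f (wordProd A (label s)) ≤
      (∑ s ∈ G.paths k, f (wordProd A (label s))) *
        ∑ s ∈ G.paths l, f (wordProd A (label s)) := by
  rw [Finset.sum_mul_sum, ← Finset.sum_product']
  let e : (Fin (k + l) → V × V × Fin m) → (Fin k → V × V × Fin m) × (Fin l → V × V × Fin m) :=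
    fun s => (fun i => s (Fin.castAdd l i), fun i => s (Fin.natAdd k i))
  have he : Function.Injective e := by
    intro s t h
    ext1 i
    refine Fin.addCases (fun i => ?_) (fun i => ?_) i
    · exact congrFun (congrArg Prod.fst h) i
    · exact congrFun (congrArg Prod.snd h) i
  calc ∑ s ∈ G.paths (k + l), f (wordProd A (label s))
      ≤ ∑ s ∈ G.paths (k + l),
          f (wordProd A (label (e s).1)) * f (wordProd A (label (e s).2)) := by
        refine Finset.sum_le_sum fun s _ => ?_
        rw [wordProd_add, mul_comm (f _)]
        exact hf _ _
    _ = ∑ x ∈ (G.paths (k + l)).image e,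
          f (wordProd A (label x.1)) * f (wordProd A (label x.2)) :=
        by
        rw [Finset.sum_image fun s _ t _ h => he h]
    _ ≤ _ := by
        -- Pairs of paths that do not join up only add nonnegative terms.
        refine Finset.sum_le_sum_of_subset_of_nonneg (fun x hx => ?_)
          fun _ _ _ => mul_nonneg (h0 _) (h0 _)
        obtain ⟨s, hs, rfl⟩ := Finset.mem_image.1 hx
        exact Finset.mem_product.2 ⟨G.castAdd_mem_paths hs, G.natAdd_mem_paths hs⟩

theorem words_nonempty {G : Automaton V m} (hG : G.StronglyConnected)
    (harcs : G.arcs.Nonempty) (k : ℕ) : (G.words k).Nonempty :=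
  (hG.paths_nonempty harcs k).image _

theorem iSup_words_add_le {G : Automaton V m} (hG : G.StronglyConnected)
    (harcs : G.arcs.Nonempty) (f : Matrix (Fin n) (Fin n) ℝ → ℝ) (h0 : ∀ M, 0 ≤ f M)
    (hf : ∀ M N, f (M * N) ≤ f M * f N) (k l : ℕ) :
    ⨆ w : G.words (k + l), f (wordProd A w.1) ≤
      (⨆ w : G.words k, f (wordProd A w.1)) * ⨆ w : G.words l, f (wordProd A w.1) := by
  have := (words_nonempty hG harcs (k + l)).to_subtype
  refine ciSup_le fun w => ?_
  obtain ⟨s, hs, hw⟩ := Finset.mem_image.1 w.2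
  rw [wordProd_add, mul_comm (iSup _)]
  refine (hf _ _).trans (mul_le_mul ?_ ?_ (h0 _) (Real.iSup_nonneg fun _ => h0 _))
  · refine le_ciSup (f := fun w : G.words l => f (wordProd A w.1)) (Set.finite_range _).bddAbove
      ⟨fun i => w.1 (Fin.natAdd k i), ?_⟩
    rw [← hw]
    exact G.label_mem_words (G.natAdd_mem_paths hs)
  · refine le_ciSup (f := fun w : G.words k => f (wordProd A w.1)) (Set.finite_range _).bddAbove
      ⟨fun i => w.1 (Fin.castAdd l i), ?_⟩
    rw [← hw]
    exact G.label_mem_words (G.castAdd_mem_paths hs)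

end Words

/-! ### Path counting and the adjacency matrix -/

section AdjacencyRadius

/-- The adjacency matrix over the natural numbers. -/
def natAdjMatrix : Matrix V V ℕ :=
  Matrix.of fun u v => (Finset.univ.filter fun σ : Fin m => (u, v, σ) ∈ G.arcs).card

theorem adjMatrix_pow (k : ℕ) : G.adjMatrix ^ k = (G.natAdjMatrix ^ k).map (Nat.cast : ℕ → ℂ) := by
  have h : G.adjMatrix = (Nat.castRingHom ℂ).mapMatrix G.natAdjMatrix := by
    ext u v
    simp [adjMatrix, natAdjMatrix]
  rw [h, ← map_pow]
  rfl

theorem sum_arcs_eq {M : Type*} [AddCommMonoid M] (u : V) (g : V → M) :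
    ∑ a ∈ G.arcs with a.1 = u, g a.2.1 = ∑ v, G.natAdjMatrix u v • g v := by
  have h : ∀ v, G.natAdjMatrix u v • g v =
      ∑ σ : Fin m, if (u, v, σ) ∈ G.arcs then g v else 0 := by
    intro v
    rw [← Finset.sum_filter, Finset.sum_const]
    rfl
  simp only [h]
  rw [← Finset.sum_product', Finset.univ_product_univ, ← Finset.sum_filter]
  refine Finset.sum_bij' (fun a _ => a.2) (fun x _ => (u, x)) ?_ ?_ ?_ ?_ ?_
  · rintro ⟨a, b, σ⟩ h
    obtain ⟨h1, rfl⟩ := Finset.mem_filter.1 h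
    simpa using h1
  · rintro ⟨b, σ⟩ h
    simpa using h
  · rintro ⟨a, b, σ⟩ h
    obtain ⟨h1, rfl⟩ := Finset.mem_filter.1 h
    rfl
  · rintro ⟨b, σ⟩ h
    rfl
  · rintro ⟨a, b, σ⟩ h
    rfl

theorem sum_natAdjMatrix_pow (k : ℕ) :
    ∀ u, ∑ v, (G.natAdjMatrix ^ k) u v = (G.pathsFrom u k).card := by
  induction k with
  | zero => intro u; simp [pathsFrom_zero, Matrix.one_apply]
  | succ k ih =>
    intro u
    rw [Finset.card_eq_sum_ones, sum_pathsFrom_succ]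
    simp only [← Finset.card_eq_sum_ones]
    rw [G.sum_arcs_eq u fun v => (G.pathsFrom v k).card]
    simp only [pow_succ', Matrix.mul_apply, ← ih, smul_eq_mul, Finset.mul_sum]
    exact Finset.sum_comm

-- The operator norm here is the largest row sum, and row `u` of the `k`-th power sums to the number
-- of paths from `u`.
open scoped Matrix.Norms.Operator in
theorem norm_adjMatrix_pow (k : ℕ) :
    ‖G.adjMatrix ^ k‖ = ((Finset.univ.sup fun u => (G.pathsFrom u k).card : ℕ) : ℝ) := by
  rw [Matrix.linfty_opNorm_def, adjMatrix_pow]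
  have h : ∀ u, ∑ v, ‖(G.natAdjMatrix ^ k).map (Nat.cast : ℕ → ℂ) u v‖₊ =
      ((G.pathsFrom u k).card : NNReal) := by
    intro u
    rw [← sum_natAdjMatrix_pow]
    simp
  simp only [h]
  rw [← NNReal.coe_natCast, NNReal.coe_inj]
  exact (Finset.apply_sup_eq_sup_comp_of_linearOrder (Nat.cast : ℕ → NNReal) Nat.mono_cast
    (by simp)).symm

open scoped Matrix.Norms.Operator in
/-- The number of paths of length `k` grows like the `k`-th power of the spectral radius of the
adjacency matrix. -/
theorem tendsto_card_paths [Nonempty V] :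
    Tendsto (fun k : ℕ => ((G.paths k).card : ℝ) ^ (1 / (k : ℝ))) atTop (𝓝 G.adjRadius) := by
  have hfin : spectralRadius ℂ G.adjMatrix ≠ ⊤ :=
    ((spectrum.spectralRadius_le_nnnorm G.adjMatrix).trans_lt ENNReal.coe_lt_top).ne
  have hgel : Tendsto (fun k : ℕ => ‖G.adjMatrix ^ k‖ ^ (1 / (k : ℝ))) atTop (𝓝 G.adjRadius) := by
    refine ((ENNReal.tendsto_toReal hfin).comp
      (spectrum.pow_norm_pow_one_div_tendsto_nhds_spectralRadius G.adjMatrix)).congr fun k => ?_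
    exact ENNReal.toReal_ofReal (Real.rpow_nonneg (norm_nonneg _) _)
  -- The number of paths lies between the largest number from one node and `|V|` times it, so
  -- Gelfand's limit carries over.
  refine tendsto_rpow_one_div_of_le_of_le one_pos
    (Nat.cast_pos.2 (Fintype.card_pos (α := V))) (fun k => norm_nonneg _) (fun k => ?_)
    (fun k => ?_) hgel
  · rw [one_mul, norm_adjMatrix_pow, Nat.cast_le]
    exact Finset.sup_le fun u _ => Finset.card_le_card (G.pathsFrom_subset u k)
  · rw [norm_adjMatrix_pow]
    refine le_trans (Nat.cast_le.2 (G.card_paths_le_sum k)) ?_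
    rw [← Nat.cast_mul, Nat.cast_le, ← smul_eq_mul, ← Finset.card_univ]
    exact Finset.sum_le_card_nsmul _ _ _ fun u hu =>
      Finset.le_sup (f := fun u => (G.pathsFrom u k).card) hu

end AdjacencyRadius

end Paths

end Automaton

/-! ### Lyapunov forms and feasibility -/

namespace Automaton

open MvPolynomial
open scoped Matrix.Norms.Frobenius

theorem bddBelow_sosValues {V : Type*} [Fintype V] {m n : ℕ} (G : Automaton V m)
    (A : Fin m → Matrix (Fin n) (Fin n) ℝ) (d : ℕ) : BddBelow (G.sosValues A d) :=
  ⟨0, fun _ ⟨_, h⟩ => h.nonneg⟩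

section Program

variable {V : Type*} [Fintype V] [DecidableEq V] {m n : ℕ} (G : Automaton V m)
  (A : Fin m → Matrix (Fin n) (Fin n) ℝ) (d : ℕ)

/-- The sum of the forms `‖A_s x‖²ᵈ` over the paths `s` of length `k` that start at `u`. -/
def pathForm (k : ℕ) (u : V) : MvPolynomial (Fin n) ℝ :=
  ∑ s ∈ G.pathsFrom u k, substMatrix (wordProd A (label s)) (normPow n d)

theorem pathForm_zero (u : V) : G.pathForm A d 0 u = normPow n d := by
  simp [pathForm, pathsFrom_zero, wordProd, substMatrix_one]

/-- Splitting off the first arc, whose matrix is the rightmost factor of the product. This recursion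
drives the telescoping. -/
theorem pathForm_succ (k : ℕ) (u : V) :
    G.pathForm A d (k + 1) u =
      ∑ a ∈ G.arcs with a.1 = u, substMatrix (A a.2.2) (G.pathForm A d k a.2.1) := by
  simp only [pathForm, sum_pathsFrom_succ, label_cons, wordProd_cons, substMatrix_sum,
    substMatrix_substMatrix]

theorem isSumSq_pathForm (k : ℕ) (u : V) : IsSumSq (G.pathForm A d k u) :=
  IsSumSq.sum fun _ _ => isSumSq_substMatrix _ (isSumSq_normPow n d)

theorem isHomogeneous_pathForm (k : ℕ) (u : V) : (G.pathForm A d k u).IsHomogeneous (2 * d) :=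
  IsHomogeneous.sum _ _ _ fun _ _ => isHomogeneous_substMatrix _ (isHomogeneous_normPow n d)

theorem isSumSq_sub_pathForm {k : ℕ} {r : ℝ}
    (hr : ∑ s ∈ G.paths k, ‖wordProd A (label s)‖ ^ (2 * d) ≤ r) (u : V) :
    IsSumSq (C r * normPow n d - G.pathForm A d k u) := by
  have hle : ∑ s ∈ G.pathsFrom u k, ‖wordProd A (label s)‖ ^ (2 * d) ≤ r :=
    (Finset.sum_le_sum_of_subset_of_nonneg (G.pathsFrom_subset u k)
      fun _ _ _ => by positivity).trans hr
  have heq : C r * normPow n d - G.pathForm A d k u =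
      C (r - ∑ s ∈ G.pathsFrom u k, ‖wordProd A (label s)‖ ^ (2 * d)) * normPow n d +
        ∑ s ∈ G.pathsFrom u k, (C (‖wordProd A (label s)‖ ^ (2 * d)) * normPow n d -
          substMatrix (wordProd A (label s)) (normPow n d)) := by
    rw [Finset.sum_sub_distrib, ← Finset.sum_mul, ← map_sum, map_sub, pathForm]
    ring
  rw [heq]
  exact ((IsSumSq.C_of_nonneg (sub_nonneg.2 hle)).mul (isSumSq_normPow n d)).add
    (IsSumSq.sum fun s _ => isSumSq_sub_substMatrix_normPow d _)

/-- The truncated Lyapunov form at `u`, with rate `g` for the forms. -/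
def lyapunovForm (g : ℝ) (K : ℕ) (u : V) : MvPolynomial (Fin n) ℝ :=
  ∑ k ∈ Finset.range K, C (g⁻¹ ^ k) * G.pathForm A d k u

theorem isHomogeneous_lyapunovForm (g : ℝ) (K : ℕ) (u : V) :
    (G.lyapunovForm A d g K u).IsHomogeneous (2 * d) :=
  IsHomogeneous.sum _ _ _ fun k _ => (G.isHomogeneous_pathForm A d k u).C_mul _

theorem isSumSq_lyapunovForm {g : ℝ} (hg : 0 ≤ g) (K : ℕ) (u : V) :
    IsSumSq (G.lyapunovForm A d g K u) :=
  IsSumSq.sum fun k _ => (IsSumSq.C_of_nonneg (by positivity)).mul (G.isSumSq_pathForm A d k u)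

theorem eval_lyapunovForm_pos {g : ℝ} (hg : 0 ≤ g) {K : ℕ} (hK : 0 < K) (u : V)
    {x : Fin n → ℝ} (hx : x ≠ 0) : 0 < eval x (G.lyapunovForm A d g K u) := by
  simp only [lyapunovForm, map_sum, map_mul, eval_C]
  refine Finset.sum_pos' (fun k _ => mul_nonneg (by positivity)
    ((G.isSumSq_pathForm A d k u).map_ringHom (eval x)).nonneg)
    ⟨0, Finset.mem_range.2 hK, ?_⟩
  rw [pathForm_zero, pow_zero, one_mul]
  exact eval_normPow_pos d hx

/-- By `pathForm_succ`, the sum over the arcs leaving `u` shifts `k` to `k + 1`. The difference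
telescopes to the terms `k = 0` and `k = K`, and `hS` controls the latter. -/
theorem isSumSq_sub_sum_lyapunovForm {g : ℝ} (hg : 0 < g) {K : ℕ}
    (hS : ∑ s ∈ G.paths K, ‖wordProd A (label s)‖ ^ (2 * d) ≤ g ^ K) (u : V) :
    IsSumSq (C g * G.lyapunovForm A d g K u -
      ∑ a ∈ G.arcs with a.1 = u, substMatrix (A a.2.2) (G.lyapunovForm A d g K a.2.1)) := by
  have h1 : ∑ a ∈ G.arcs with a.1 = u, substMatrix (A a.2.2) (G.lyapunovForm A d g K a.2.1) =
      ∑ k ∈ Finset.range K, C (g * g⁻¹ ^ (k + 1)) * G.pathForm A d (k + 1) u := by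
    simp only [lyapunovForm, substMatrix_sum, substMatrix_C_mul, pathForm_succ]
    rw [Finset.sum_comm]
    refine Finset.sum_congr rfl fun k _ => ?_
    rw [pow_succ', mul_inv_cancel_left₀ hg.ne', Finset.mul_sum]
  have h2 : C g * G.lyapunovForm A d g K u =
      ∑ k ∈ Finset.range K, C (g * g⁻¹ ^ k) * G.pathForm A d k u := by
    simp only [lyapunovForm, Finset.mul_sum, map_mul, mul_assoc]
  rw [h1, h2, ← Finset.sum_sub_distrib,
    Finset.sum_range_sub' fun k => C (g * g⁻¹ ^ k) * G.pathForm A d k u, pathForm_zero]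
  have h3 : C (g * g⁻¹ ^ 0) * normPow n d - C (g * g⁻¹ ^ K) * G.pathForm A d K u =
      C (g * g⁻¹ ^ K) * (C (g ^ K) * normPow n d - G.pathForm A d K u) := by
    rw [mul_sub, ← mul_assoc, ← map_mul, mul_assoc, ← mul_pow, inv_mul_cancel₀ hg.ne', one_pow,
      pow_zero]
  rw [h3]
  exact (IsSumSq.C_of_nonneg (by positivity)).mul (G.isSumSq_sub_pathForm A d hS u)

/-- The terms of the other arcs leaving `u` are sums of squares, so adding them back to the previous
difference isolates a single arc. -/
theorem isSumSq_arc_lyapunovForm {g : ℝ} (hg : 0 < g) {K : ℕ}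
    (hS : ∑ s ∈ G.paths K, ‖wordProd A (label s)‖ ^ (2 * d) ≤ g ^ K) {u v : V} {σ : Fin m}
    (harc : (u, v, σ) ∈ G.arcs) :
    IsSumSq (C g * G.lyapunovForm A d g K u - substMatrix (A σ) (G.lyapunovForm A d g K v)) := by
  have hmem : (u, v, σ) ∈ G.arcs.filter fun a => a.1 = u := Finset.mem_filter.2 ⟨harc, rfl⟩
  have h := (G.isSumSq_sub_sum_lyapunovForm A d hg hS u).add
    (IsSumSq.sum (I := (G.arcs.filter fun a => a.1 = u).erase (u, v, σ))
      (s := fun a => substMatrix (A a.2.2) (G.lyapunovForm A d g K a.2.1))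
      fun a _ => isSumSq_substMatrix _ (G.isSumSq_lyapunovForm A d hg.le K a.2.1))
  rw [← Finset.add_sum_erase _ _ hmem] at h
  rwa [sub_add_eq_sub_sub, sub_add_cancel] at h

theorem mem_sosValues [Nonempty V] (hn : 0 < n) {γ : ℝ} (hγ : 0 < γ) {K : ℕ} (hK : 0 < K)
    (hS : ∑ s ∈ G.paths K, ‖wordProd A (label s)‖ ^ (2 * d) ≤ (γ ^ (2 * d)) ^ K) :
    γ ∈ G.sosValues A d := by
  have hg : 0 < γ ^ (2 * d) := pow_pos hγ _
  set p := G.lyapunovForm A d (γ ^ (2 * d)) K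
  have hpos : ∀ v, ∀ x : Fin n → ℝ, x ≠ 0 → 0 < eval x (p v) :=
    fun v x hx => G.eval_lyapunovForm_pos A d hg.le hK v hx
  -- The conditions other than normalization are invariant under a common positive scaling, so
  -- dividing by `c` normalizes.
  set c := ∑ v, sphereIntegral (p v)
  have hc0 : 0 < c :=
    Finset.sum_pos (fun v _ => sphereIntegral_pos hn (hpos v)) Finset.univ_nonempty
  have hci : IsSumSq (C c⁻¹ : MvPolynomial (Fin n) ℝ) := IsSumSq.C_of_nonneg (by positivity)
  refine ⟨fun v => C c⁻¹ * p v, hγ.le, fun v => (G.isHomogeneous_lyapunovForm A d _ K v).C_mul _,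
    fun u v σ harc => ?_, fun v => hci.mul (G.isSumSq_lyapunovForm A d hg.le K v),
    fun v x hx => ?_, ?_⟩
  · rw [substMatrix_C_mul, mul_left_comm, ← mul_sub]
    exact hci.mul (G.isSumSq_arc_lyapunovForm A d hg hS harc)
  · rw [map_mul, eval_C]
    exact mul_pos (inv_pos.2 hc0) (hpos v x hx)
  · simp only [sphereIntegral_C_mul, ← Finset.mul_sum]
    exact inv_mul_cancel₀ hc0.ne'

end Program

/-! ### Existence and comparison of the limits -/

section Limits

variable {V : Type*} [Fintype V] [DecidableEq V] {m n : ℕ} {G : Automaton V m}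
  (A : Fin m → Matrix (Fin n) (Fin n) ℝ) (ν : Seminorm ℝ (Matrix (Fin n) (Fin n) ℝ))

/-- The Frobenius norm is submultiplicative, while `ν` need not be. Passing to `ν` costs constants
raised to the fixed exponent `k`, which the `l`-th root removes. The common `L` ties the Frobenius
certificate to the radius computed with `ν`. -/
theorem exists_tendsto_sum_paths (hν : ∀ M, ν M = 0 → M = 0) (k : ℕ) :
    ∃ L : ℝ, 0 ≤ L ∧
      Tendsto (fun l : ℕ => (∑ s ∈ G.paths l, ‖wordProd A (label s)‖ ^ k) ^ (1 / (l : ℝ)))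
        atTop (𝓝 L) ∧
      Tendsto (fun l : ℕ => (∑ s ∈ G.paths l, ν (wordProd A (label s)) ^ k) ^ (1 / (l : ℝ)))
        atTop (𝓝 L) := by
  obtain ⟨c, C, hc, hC, h⟩ := ν.exists_equiv_norm hν
  obtain ⟨L, hL0, hL⟩ := exists_tendsto_rpow_one_div_of_submultiplicative
    (u := fun l => ∑ s ∈ G.paths l, ‖wordProd A (label s)‖ ^ k)
    (fun l => Finset.sum_nonneg fun s _ => by positivity)
    (G.sum_paths_add_le A (fun M => ‖M‖ ^ k) (fun M => by positivity) fun M N => by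
      rw [← mul_pow]
      exact pow_le_pow_left₀ (norm_nonneg _) (norm_mul_le M N) k)
  refine ⟨L, hL0, hL, tendsto_rpow_one_div_of_le_of_le (pow_pos hc k) (pow_pos hC k)
    (fun l => Finset.sum_nonneg fun s _ => by positivity) (fun l => ?_) (fun l => ?_) hL⟩
  · rw [Finset.mul_sum]
    refine Finset.sum_le_sum fun s _ => ?_
    rw [← mul_pow]
    exact pow_le_pow_left₀ (by positivity) (h _).1 k
  · rw [Finset.mul_sum]
    refine Finset.sum_le_sum fun s _ => ?_
    rw [← mul_pow]
    exact pow_le_pow_left₀ (apply_nonneg _ _) (h _).2 k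

theorem cjsrSeq_eq (hG : G.StronglyConnected) (harcs : G.arcs.Nonempty) (k : ℕ) :
    G.cjsrSeq A ν k = (⨆ w : G.words k, ν (wordProd A w.1)) ^ (1 / (k : ℝ)) := by
  have := (words_nonempty hG harcs k).to_subtype
  have hk : (0 : ℝ) ≤ 1 / (k : ℝ) := by positivity
  refine le_antisymm (ciSup_le fun w => Real.rpow_le_rpow (apply_nonneg _ _)
    (le_ciSup (f := fun w : G.words k => ν (wordProd A w.1)) (Set.finite_range _).bddAbove w) hk) ?_
  obtain ⟨w, hw⟩ := exists_eq_ciSup_of_finite (f := fun w : G.words k => ν (wordProd A w.1))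
  rw [← hw]
  exact le_ciSup (f := fun w : G.words k => ν (wordProd A w.1) ^ (1 / (k : ℝ)))
    (Set.finite_range _).bddAbove w

theorem tendsto_cjsrSeq (hG : G.StronglyConnected) (harcs : G.arcs.Nonempty)
    (hν : ∀ M, ν M = 0 → M = 0) : Tendsto (G.cjsrSeq A ν) atTop (𝓝 (G.cjsr A ν)) := by
  obtain ⟨c, C, hc, hC, h⟩ := ν.exists_equiv_norm hν
  obtain ⟨L, -, hL⟩ := exists_tendsto_rpow_one_div_of_submultiplicative
    (u := fun k => ⨆ w : G.words k, ‖wordProd A w.1‖)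
    (fun k => Real.iSup_nonneg fun w => norm_nonneg _)
    (iSup_words_add_le A hG harcs (fun M => ‖M‖) norm_nonneg norm_mul_le)
  refine tendsto_nhds_limUnder ⟨L, ?_⟩
  rw [show G.cjsrSeq A ν = _ from funext (cjsrSeq_eq A ν hG harcs)]
  refine tendsto_rpow_one_div_of_le_of_le hc hC
    (fun k => Real.iSup_nonneg fun w => norm_nonneg _) (fun k => ?_) (fun k => ?_) hL
  · rw [Real.mul_iSup_of_nonneg hc.le]
    exact ciSup_mono (Set.finite_range _).bddAbove fun w => (h _).1
  · rw [Real.mul_iSup_of_nonneg hC.le]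
    exact ciSup_mono (Set.finite_range _).bddAbove fun w => (h _).2

theorem radiusSeq_le_cjsrSeq (hG : G.StronglyConnected) (harcs : G.arcs.Nonempty) {p : ℝ}
    (hp : 0 < p) {k : ℕ} (hk : 0 < k) : G.radiusSeq A ν p k ≤ G.cjsrSeq A ν k := by
  have hcard : (0 : ℝ) < (G.paths k).card :=
    Nat.cast_pos.2 (Finset.card_pos.2 (hG.paths_nonempty harcs k))
  have hk' : (0 : ℝ) < k := by exact_mod_cast hk
  rw [cjsrSeq_eq A ν hG harcs]
  set M := ⨆ w : G.words k, ν (wordProd A w.1)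
  have hM0 : 0 ≤ M := Real.iSup_nonneg fun w => apply_nonneg _ _
  have hle : ((G.paths k).card : ℝ)⁻¹ * ∑ s ∈ G.paths k, ν (wordProd A (label s)) ^ p ≤ M ^ p := by
    rw [inv_mul_le_iff₀ hcard, ← nsmul_eq_mul]
    refine Finset.sum_le_card_nsmul _ _ _ fun s hs => ?_
    exact Real.rpow_le_rpow (apply_nonneg _ _) (le_ciSup
      (f := fun w : G.words k => ν (wordProd A w.1)) (Set.finite_range _).bddAbove
      ⟨label s, G.label_mem_words hs⟩) hp.le
  refine (Real.rpow_le_rpow (mul_nonneg (by positivity) (Finset.sum_nonneg fun s _ =>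
    Real.rpow_nonneg (apply_nonneg _ _) _)) hle (by positivity)).trans_eq ?_
  rw [← Real.rpow_mul hM0]
  congr 1
  field_simp

/-- There is a path of every length. The bound permits division by the spectral radius in the limits
below. -/
theorem one_le_adjRadius [Nonempty V] (hG : G.StronglyConnected) (harcs : G.arcs.Nonempty) :
    1 ≤ G.adjRadius :=
  ge_of_tendsto' G.tendsto_card_paths fun k => Real.one_le_rpow
    (Nat.one_le_cast.2 (Finset.card_pos.2 (hG.paths_nonempty harcs k))) (by positivity)

/-- This separates the path sum from the path count, whose growth rates are known individually. -/
theorem radiusSeq_eq (d k : ℕ) :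
    G.radiusSeq A ν (2 * (d : ℝ)) k =
      ((∑ s ∈ G.paths k, ν (wordProd A (label s)) ^ (2 * d)) ^ (1 / (k : ℝ)) /
        ((G.paths k).card : ℝ) ^ (1 / (k : ℝ))) ^ (1 / (2 * (d : ℝ))) := by
  have hS : 0 ≤ ∑ s ∈ G.paths k, ν (wordProd A (label s)) ^ (2 * d) :=
    Finset.sum_nonneg fun s _ => pow_nonneg (apply_nonneg _ _) _
  rw [← Real.div_rpow hS (by positivity), ← Real.rpow_mul (by positivity), radiusSeq,
    inv_mul_eq_div]
  congr 1
  · congr 1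
    refine Finset.sum_congr rfl fun s _ => ?_
    rw [← Real.rpow_natCast]
    push_cast
    rfl
  · rw [one_div_mul_one_div, mul_comm]

theorem tendsto_radiusSeq [Nonempty V] (hG : G.StronglyConnected) (harcs : G.arcs.Nonempty)
    {d : ℕ} (hd : 0 < d) {L : ℝ}
    (hL : Tendsto (fun l : ℕ => (∑ s ∈ G.paths l, ν (wordProd A (label s)) ^ (2 * d)) ^
      (1 / (l : ℝ))) atTop (𝓝 L)) :
    Tendsto (G.radiusSeq A ν (2 * (d : ℝ))) atTop
      (𝓝 ((L / G.adjRadius) ^ (1 / (2 * (d : ℝ))))) := by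
  have hρ : 0 < G.adjRadius := one_pos.trans_le (one_le_adjRadius hG harcs)
  have hd0 : (0 : ℝ) < 2 * (d : ℝ) := by positivity
  have h := (hL.div G.tendsto_card_paths hρ.ne').rpow_const (p := 1 / (2 * (d : ℝ)))
    (Or.inr (one_div_pos.2 hd0).le)
  exact h.congr fun k => (radiusSeq_eq A ν d k).symm

/-- Every `γ` above the growth rate of the path sums of the Frobenius norm is attained. -/
theorem mem_sosValues_of_lt [Nonempty V] (hn : 0 < n) {d : ℕ} (hd : 0 < d) {L : ℝ} (hL0 : 0 ≤ L)
    (hL : Tendsto (fun l : ℕ => (∑ s ∈ G.paths l, ‖wordProd A (label s)‖ ^ (2 * d)) ^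
      (1 / (l : ℝ))) atTop (𝓝 L)) {γ : ℝ} (hγ : L ^ (1 / (2 * (d : ℝ))) < γ) :
    γ ∈ G.sosValues A d := by
  have hd0 : (0 : ℝ) < 2 * (d : ℝ) := by positivity
  have hγ0 : 0 < γ := (Real.rpow_nonneg hL0 _).trans_lt hγ
  have hlt : L < γ ^ (2 * d) := by
    have h := (Real.rpow_lt_rpow_iff (Real.rpow_nonneg hL0 _) hγ0.le hd0).2 hγ
    rw [← Real.rpow_mul hL0, one_div_mul_cancel hd0.ne', Real.rpow_one] at h
    rw [← Real.rpow_natCast]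
    push_cast
    exact h
  -- Besides allowing the `K`-th root to be undone, `K > 0` keeps the term `k = 0` in the Lyapunov
  -- form, which makes it positive definite.
  obtain ⟨K, hK1, hK⟩ := ((hL.eventually_lt_const hlt).and (eventually_gt_atTop 0)).exists
  refine G.mem_sosValues A d hn hγ0 hK ?_
  have hS : 0 ≤ ∑ s ∈ G.paths K, ‖wordProd A (label s)‖ ^ (2 * d) :=
    Finset.sum_nonneg fun s _ => by positivity
  rw [← Real.rpow_inv_natCast_pow hS hK.ne', ← one_div]
  exact pow_le_pow_left₀ (Real.rpow_nonneg hS _) hK1.le K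

end Limits

end Automaton

end

open Automaton in
theorem mainTheorem1 {V : Type*} [Fintype V] [DecidableEq V] {m n : ℕ} (hn : 0 < n)
    (G : Automaton V m) (hG : G.StronglyConnected) (harcs : G.arcs.Nonempty)
    (A : Fin m → Matrix (Fin n) (Fin n) ℝ)
    (ν : Seminorm ℝ (Matrix (Fin n) (Fin n) ℝ)) (hν : ∀ M, ν M = 0 → M = 0)
    (d : ℕ) (hd : 0 < d) :
    (G.sosValues A d).Nonempty ∧
    Tendsto (G.radiusSeq A ν (2 * (d : ℝ))) atTop (𝓝 (G.radius A ν (2 * (d : ℝ)))) ∧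
    Tendsto (G.cjsrSeq A ν) atTop (𝓝 (G.cjsr A ν)) ∧
    G.sosBound A d ≤
      G.adjRadius ^ (1 / (2 * (d : ℝ))) * G.radius A ν (2 * (d : ℝ)) ∧
    G.adjRadius ^ (1 / (2 * (d : ℝ))) * G.radius A ν (2 * (d : ℝ)) ≤
      G.adjRadius ^ (1 / (2 * (d : ℝ))) * G.cjsr A ν := by
  have : Nonempty V := ⟨harcs.choose.1⟩
  obtain ⟨L, hL0, hL, hLν⟩ := exists_tendsto_sum_paths (G := G) A ν hν (2 * d)
  have hρ : 0 < G.adjRadius := one_pos.trans_le (one_le_adjRadius hG harcs)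
  have hd0 : (0 : ℝ) < 2 * (d : ℝ) := by positivity
  have hrad := tendsto_radiusSeq A ν hG harcs hd hLν
  have hradeq : G.radius A ν (2 * (d : ℝ)) = (L / G.adjRadius) ^ (1 / (2 * (d : ℝ))) :=
    hrad.limUnder_eq
  have hcjsr := tendsto_cjsrSeq A ν hG harcs hν
  refine ⟨⟨_, mem_sosValues_of_lt A hn hd hL0 hL (lt_add_one _)⟩, hradeq ▸ hrad, hcjsr, ?_, ?_⟩
  -- The spectral radius cancels and leaves `L ^ (1 / (2 * d))`, every `γ` above which is feasible.
  · rw [hradeq, ← Real.mul_rpow hρ.le (by positivity), mul_div_cancel₀ _ hρ.ne']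
    exact le_of_forall_gt_imp_ge_of_dense fun γ hγ =>
      csInf_le (G.bddBelow_sosValues A d) (mem_sosValues_of_lt A hn hd hL0 hL hγ)
  · rw [hradeq]
    refine mul_le_mul_of_nonneg_left (le_of_tendsto_of_tendsto hrad hcjsr ?_) (by positivity)
    filter_upwards [eventually_gt_atTop 0] with k hk
    exact radiusSeq_le_cjsrSeq A ν hG harcs hd0 hk
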